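/- Let $R$ be an integral domain with field of fractions $\mathbb F$. Let $A_0\subseteq A_1\subseteq A_2\subseteq\cdots$ be an increasing sequence of cellular $R$-algebras (in the sense of Graham–Lehrer) with unital inclusions and compatible involutions $*$. Write $(\widehat A_r,\unrhd)$ for the finite poset in the cell datum of $A_r$, $\Delta_r(\lambda)$ for the (nonzero, right) cell module of $\lambda\in\widehat A_r$, and $A_r^{\unrhd\lambda}$, $A_r^{\rhd\lambda}$ for the associated two-sided ideals; put $A_r^{\mathbb F}=\mathbb F\otimes_R A_r$ and $\Delta_r^{\mathbb F}(\lambda)=\mathbb F\otimes_R\Delta_r(\lambda)$. Assume that the sequence is a tower of diagram algebras, i.e.: 1. $A_0=R$. 2. Every cell module is cyclic. Fix a generator $\delta(\lambda)$ of each $\Delta_r(\lambda)$, an $A_r$-bimodule isomorphism $\alpha_\lambda:A_r^{\unrhd\lambda}/A_r^{\rhd\lambda}\to\Delta_r(\lambda)^*\otimes_R\Delta_r(\lambda)$, and a lift $m_\lambda\in A_r^{\unrhd\lambda}$ of $\alpha_\lambda^{-1}(\delta(\lambda)^*\otimes\delta(\lambda))$. 3. $m_\lambda^*=m_\lambda$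 for all $\lambda$. 4. $A_r^{\mathbb F}$ is split semisimple for all $r$. 5. For all $r$ and $\lambda\in\widehat A_{r+1}$, the restriction of $\Delta_{r+1}(\lambda)$ to $A_r$ has an order preserving cell filtration $0=N_0\subseteq\cdots\subseteq N_s$, i.e. $N_j/N_{j-1}\cong\Delta_r(\mu_j)$ with $\mu_1\rhd\mu_2\rhd\cdots\rhd\mu_s$ in $\widehat A_r$. The branching diagram $\widehat A$ has vertex set $\widehat A_r$ at level $r$ and an edge $\mu\to\lambda$ whenever $\mu$ is one of the $\mu_j$ in such a filtration. Fix branching factors $d_{\mu\to\lambda}\in A_{r+1}$ for the edges $\mu\to\lambda$: for each $\lambda$ there are a filtration as above and isomorphisms $N_j/N_{j-1}\cong\Delta_r(\mu_j)$ such that $\delta(\lambda)d_{\mu_j\to\lambda}\in N_j$ and its class corresponds to $\delta(\mu_j)$. 6. For each edge $\mu\to\lambda$, $\lambda\in\widehat A_{r+1}$, there is $u_{\mu\to\lambda}\in A_{r+1}$ with $m_\lambda d_{\mu\to\lambda}=(u_{\mu\to\lambda})^*m_\mu$. For $\lambda\in\widehat A_r$ let $\mathrm{Std}_r(\lambda)$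 be the set of directed paths $\mathsf t=(\mathsf t(0)\to\mathsf t(1)\to\cdots\to\mathsf t(r)=\lambda)$ in $\widehat A$ starting at level $0$. Put $d_{\mathsf t}=d_{\mathsf t(r-1)\to\mathsf t(r)}\cdots d_{\mathsf t(0)\to\mathsf t(1)}$ and $m_{\mathsf t}^\lambda=\delta(\lambda)d_{\mathsf t}\in\Delta_r(\lambda)$ (equivalently $m_\lambda d_{\mathsf t}+A_r^{\rhd\lambda}$). Let $z_\lambda$ be the minimal central idempotent of $A_r^{\mathbb F}$ acting as the identity on $\Delta_r^{\mathbb F}(\lambda)$, let $F_{\mathsf t}=\prod_{s=1}^r z_{\mathsf t(s)}\in A_r^{\mathbb F}$, and define $f^\lambda_{\mathsf t}=m^\lambda_{\mathsf t}F_{\mathsf t}\in\Delta^{\mathbb F}_r(\lambda)$. An additive (resp. multiplicative) family of Jucys–Murphy elements is a family $(L_r)_{r\ge1}$ such that, for all $r\ge1$, $L_r\in A_r$ is $*$-invariant and commutes with $A_{r-1}$ (and, in the multiplicative case, is invertible in $A_r$), and for all $\lambda\in\widehat A_r$ there is $d(\lambda)\in R$ such that $L_1+\cdots+L_r$ (resp.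 $L_1\cdots L_r$) acts as the scalar $d(\lambda)$ on $\Delta_r(\lambda)$; for $\lambda\in\widehat A_0$ put $d(\lambda)=0$ (resp. $d(\lambda)=1$). **Proposition.** Additive or multiplicative Jucys–Murphy elements act diagonally on the seminormal bases. That is, for all $r$ and $\lambda\in\widehat A_r$ the family $\{f^\lambda_{\mathsf t}\mid\mathsf t\in\mathrm{Std}_r(\lambda)\}$ is an $\mathbb F$-basis of $\Delta_r^{\mathbb F}(\lambda)$; and if $(L_i)_{i\ge 1}$ is an additive (resp. multiplicative) family of Jucys–Murphy elements, there exist scalars $\kappa_{\mu\to\lambda}\in R$ attached to the edges $\mu\to\lambda$ of $\widehat A$, namely $\kappa_{\mu\to\lambda}=d(\lambda)-d(\mu)$ (resp. $\kappa_{\mu\to\lambda}=d(\lambda)d(\mu)^{-1}$, where $d(\mu)$ is a unit of $R$), such that for all $r$, all $\lambda\in\widehat A_r$, all $\mathsf t\in\mathrm{Std}_r(\lambda)$ and all $1\le i\le r$, $$f^\lambda_{\mathsf t}L_i=\kappa_{\mathsf t(i-1)\to\mathsf t(i)}\,f^\lambda_{\mathsf t}.$$ -/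

import Mathlib

open scoped TensorProduct

universe u uF v w w'

/-- A cell datum for the unital `R`-algebra `A`.  The relation `⊵` on `Â` is written `≥`,
so that `mu ▷ lam` is `lam < mu`.  The index sets `Std(lam)` of the given cellular basis are
called `M lam`; they are nonempty, i.e. the cell modules are nonzero. -/
structure CellDatum (R : Type u) (A : Type v) [CommRing R] [Ring A] [Algebra R A] where
  /-- the poset `Â` -/
  Lam : Type w
  [partialOrder : PartialOrder Lam]
  [finiteLam : Finite Lam]
  /-- the index sets of the cellular basis -/
  M : Lam → Type w'
  [fintypeM : ∀ lam, Fintype (M lam)]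
  [nonemptyM : ∀ lam, Nonempty (M lam)]
  /-- the involution `*` -/
  inv : A →ₗ[R] A
  inv_mul : ∀ x y, inv (x * y) = inv y * inv x
  inv_inv : ∀ x, inv (inv x) = x
  /-- the cellular basis; `c ⟨lam, s, t⟩` is `c_{st}^lam` -/
  c : Module.Basis (Σ lam, M lam × M lam) R A
  /-- `c_{st} a ≡ ∑_v r(a; t, v) c_{sv}` modulo `A^{▷ lam}`, with coefficients independent
  of `s` -/
  mul_cell : ∀ (lam : Lam) (t : M lam) (a : A), ∃ r : M lam → R, ∀ s : M lam,
    c ⟨lam, s, t⟩ * a - ∑ v, r v • c ⟨lam, s, v⟩ ∈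
      Submodule.span R {y : A | ∃ (mu : Lam) (p : M mu × M mu), lam < mu ∧ y = c ⟨mu, p⟩}
  /-- `(c_{st})^* ≡ c_{ts}` modulo `A^{▷ lam}` -/
  inv_cell : ∀ (lam : Lam) (s t : M lam),
    inv (c ⟨lam, s, t⟩) - c ⟨lam, t, s⟩ ∈
      Submodule.span R {y : A | ∃ (mu : Lam) (p : M mu × M mu), lam < mu ∧ y = c ⟨mu, p⟩}

namespace CellDatum

attribute [instance] CellDatum.partialOrder CellDatum.finiteLam CellDatum.fintypeM
  CellDatum.nonemptyM

section

variable {R : Type u} {A : Type v} [CommRing R] [Ring A] [Algebra R A]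
  (C : CellDatum.{u, v, w, w'} R A)

noncomputable instance instDecidableEqM (lam : C.Lam) : DecidableEq (C.M lam) :=
  Classical.decEq _

/-- `A^{▷ lam}` -/
def above (lam : C.Lam) : Submodule R A :=
  Submodule.span R {y : A | ∃ (mu : C.Lam) (p : C.M mu × C.M mu), lam < mu ∧ y = C.c ⟨mu, p⟩}

/-- `A^{⊵ lam}` -/
def atLeast (lam : C.Lam) : Submodule R A :=
  Submodule.span R {y : A | ∃ (mu : C.Lam) (p : C.M mu × C.M mu), lam ≤ mu ∧ y = C.c ⟨mu, p⟩}

/-- The structure constants `r(a; t, v)`. -/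
noncomputable def coeff (lam : C.Lam) (a : A) (t v : C.M lam) : R :=
  Classical.choose (C.mul_cell lam t a) v

lemma coeff_spec (lam : C.Lam) (a : A) (s t : C.M lam) :
    C.c ⟨lam, s, t⟩ * a - ∑ v, C.coeff lam a t v • C.c ⟨lam, s, v⟩ ∈ C.above lam :=
  Classical.choose_spec (C.mul_cell lam t a) s

lemma repr_above (lam : C.Lam) (p : C.M lam × C.M lam) {y : A} (hy : y ∈ C.above lam) :
    C.c.repr y ⟨lam, p⟩ = 0 := by
  classical
  unfold above at hy
  induction hy using Submodule.span_induction with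
  | mem y hy =>
    obtain ⟨mu, q, hlt, rfl⟩ := hy
    rw [Module.Basis.repr_self, Finsupp.single_apply, if_neg]
    intro h
    exact hlt.ne (congrArg Sigma.fst h).symm
  | zero => simp
  | add x y _ _ hx hy => simp [hx, hy]
  | smul a x _ hx => simp [hx]

lemma coeff_eq (lam : C.Lam) (a : A) (s t v : C.M lam) :
    C.coeff lam a t v = C.c.repr (C.c ⟨lam, s, t⟩ * a) ⟨lam, s, v⟩ := by
  classical
  have h := C.repr_above lam (s, v) (C.coeff_spec lam a s t)
  rw [map_sub, Finsupp.sub_apply, sub_eq_zero] at h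
  rw [h, map_sum, Finsupp.finsetSum_apply, Finset.sum_eq_single v]
  · simp
  · intro b _ hb
    rw [map_smul, Module.Basis.repr_self, Finsupp.smul_apply, Finsupp.single_apply, if_neg]
    · simp
    · intro h
      apply hb
      simpa using h
  · simp

lemma above_mul (lam : C.Lam) {y : A} (hy : y ∈ C.above lam) (a : A) :
    y * a ∈ C.above lam := by
  unfold above at hy
  induction hy using Submodule.span_induction with
  | mem y hy =>
    obtain ⟨mu, ⟨s, t⟩, hlt, rfl⟩ := hy
    have h := C.coeff_spec mu a s t
    have hle : C.above mu ≤ C.above lam := by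
      apply Submodule.span_mono
      rintro _ ⟨nu, q, h1, rfl⟩
      exact ⟨nu, q, hlt.trans h1, rfl⟩
    have h2 : ∑ v, C.coeff mu a t v • C.c ⟨mu, s, v⟩ ∈ C.above lam :=
      Submodule.sum_mem _ fun v _ =>
        Submodule.smul_mem _ _ (Submodule.subset_span ⟨mu, _, hlt, rfl⟩)
    simpa using Submodule.add_mem _ (hle h) h2
  | zero => simp
  | add x y _ _ hx hy => rw [add_mul]; exact Submodule.add_mem _ hx hy
  | smul r x _ hx => rw [smul_mul_assoc]; exact Submodule.smul_mem _ _ hx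

lemma coeff_mul (lam : C.Lam) (a b : A) (t v : C.M lam) :
    C.coeff lam (a * b) t v = ∑ x, C.coeff lam a t x * C.coeff lam b x v := by
  have h := C.repr_above lam (t, v) (C.above_mul lam (C.coeff_spec lam a t t) b)
  rw [sub_mul, map_sub, Finsupp.sub_apply, sub_eq_zero, mul_assoc] at h
  rw [C.coeff_eq lam (a * b) t t v, h, Finset.sum_mul, map_sum, Finsupp.finsetSum_apply]
  refine Finset.sum_congr rfl fun x _ => ?_
  rw [smul_mul_assoc, map_smul, Finsupp.smul_apply, smul_eq_mul, ← C.coeff_eq]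

/-- The cell module `Δ(lam)` in matrix form: the algebra map sending `a` to the matrix
`(r(a; t, v))_{t, v}`, which acts on row vectors from the right. -/
noncomputable def rep (lam : C.Lam) : A →ₐ[R] Matrix (C.M lam) (C.M lam) R :=
  AlgHom.ofLinearMap
    { toFun := fun a => Matrix.of fun t v => C.coeff lam a t v
      map_add' := fun a b => by
        ext t v
        simp [C.coeff_eq lam _ t t v, mul_add]
      map_smul' := fun r a => by
        ext t v
        simp [C.coeff_eq lam _ t t v] }
    (by
      classical
      ext t v
      simp [C.coeff_eq lam _ t t v, Finsupp.single_apply, Matrix.one_apply])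
    (fun a b => by
      ext t v
      simp [C.coeff_mul, Matrix.mul_apply])

/-- The underlying free `R`-module of the cell module `Δ(lam)`; the coordinate vector at
`t` is `c_t`. -/
abbrev Cell (lam : C.Lam) : Type (max w' u) := C.M lam → R

/-- The right action of `A` on the cell module: `C.act lam a x` is `x a`, so that
`c_t a = ∑_v r(a; t, v) c_v`. -/
noncomputable def act (lam : C.Lam) (a : A) : C.Cell lam →ₗ[R] C.Cell lam :=
  Matrix.vecMulLinear (C.rep lam a)

variable (F : Type uF) [Field F] [Algebra R F]

/-- The matrix form of the cell module `Δ^F(lam)` of `A^F = F ⊗[R] A`, the extension of scalars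
of `C.rep lam`. -/
noncomputable def repF (lam : C.Lam) : F ⊗[R] A →ₐ[F] Matrix (C.M lam) (C.M lam) F :=
  Algebra.TensorProduct.lift (Algebra.ofId F _)
    (((Algebra.ofId R F).mapMatrix (m := C.M lam)).comp (C.rep lam))
    (fun x _ => Algebra.commutes x _)

/-- The underlying `F`-vector space of `Δ^F(lam)`. -/
abbrev CellF (lam : C.Lam) : Type (max w' uF) := C.M lam → F

/-- The right action of `A^F` on `Δ^F(lam)`: `C.actF F lam b x` is `x b`. -/
noncomputable def actF (lam : C.Lam) (b : F ⊗[R] A) : C.CellF F lam →ₗ[F] C.CellF F lam :=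
  Matrix.vecMulLinear (C.repF F lam b)

/-- The inclusion `Δ(lam) → Δ^F(lam)`. -/
def toCellF (lam : C.Lam) (x : C.Cell lam) : C.CellF F lam := fun t => algebraMap R F (x t)

end

end CellDatum

/-- `z` is a minimal central idempotent of `B`: a nonzero central idempotent such that every
central idempotent below it is `0` or `z`. -/
structure IsMinimalCentralIdempotent {B : Type*} [Ring B] (z : B) : Prop where
  central : z ∈ Set.center B
  idem : z * z = z
  ne_zero : z ≠ 0
  minimal : ∀ e ∈ Set.center B, e * e = e → e * z = e → e = 0 ∨ e = z

/-- A split semisimple algebra over the field `F`: a finite direct product of full matrix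
algebras over `F`. -/
def IsSplitSemisimple (F : Type*) (B : Type*) [Field F] [Ring B] [Algebra F B] : Prop :=
  ∃ (n : ℕ) (k : Fin n → ℕ),
    Nonempty (B ≃ₐ[F] (∀ i, Matrix (Fin (k i)) (Fin (k i)) F))

/-- An increasing sequence of cellular algebras over `R`, with unital inclusions and consistent
involutions. -/
structure CellularTower (R : Type u) (A : ℕ → Type v) [CommRing R] [∀ r, Ring (A r)]
    [∀ r, Algebra R (A r)] where
  cell : ∀ r, CellDatum.{u, v, w, w'} R (A r)
  incl : ∀ r, A r →ₐ[R] A (r + 1)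
  incl_injective : ∀ r, Function.Injective (incl r)
  incl_inv : ∀ r a, (cell (r + 1)).inv (incl r a) = incl r ((cell r).inv a)

namespace CellularTower

section

variable {R : Type u} {A : ℕ → Type v} [CommRing R] [∀ r, Ring (A r)] [∀ r, Algebra R (A r)]
  (T : CellularTower.{u, v, w, w'} R A)

/-- The vertex set `Â_r` of the branching diagram at level `r`. -/
abbrev Vertex (r : ℕ) : Type w := (T.cell r).Lam

/-- The inclusion `A_i → A_r` for `i ≤ r`. -/
def inclLE {i r : ℕ} (h : i ≤ r) : A i →ₐ[R] A r :=
  Nat.leRecOn (C := fun k => A i →ₐ[R] A k) h (fun {k} f => (T.incl k).comp f)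
    (AlgHom.id R (A i))

/-- An order preserving cell filtration `0 = N_0 ⊆ N_1 ⊆ ⋯ ⊆ N_s` of the restriction of
`Δ_{r+1}(lam)` to `A_r`, together with isomorphisms of the successive quotients with cell modules
of `A_r`.  The isomorphism `N_{j+1} / N_j ≅ Δ_r(label j)` is recorded as a surjective `A_r`-linear
map `N_{j+1} → Δ_r(label j)` with kernel `N_j`. -/
structure RestrictionFiltration (r : ℕ) (lam : T.Vertex (r + 1)) where
  length : ℕ
  label : Fin length → T.Vertex r
  label_anti : ∀ i j, i < j → label j < label i
  N : Fin (length + 1) → Submodule R ((T.cell (r + 1)).Cell lam)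
  N_mono : Monotone N
  N_zero : N 0 = ⊥
  N_last : N (Fin.last length) = ⊤
  N_act : ∀ j (a : A r), ∀ x ∈ N j, (T.cell (r + 1)).act lam (T.incl r a) x ∈ N j
  quot : ∀ j : Fin length, N j.succ →ₗ[R] (T.cell r).Cell (label j)
  quot_surjective : ∀ j, Function.Surjective (quot j)
  quot_ker : ∀ j (x : N j.succ), quot j x = 0 ↔ (x : (T.cell (r + 1)).Cell lam) ∈ N j.castSucc
  quot_act : ∀ j (a : A r) (x : N j.succ),
    quot j ⟨(T.cell (r + 1)).act lam (T.incl r a) x, N_act _ a _ x.2⟩ =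
      (T.cell r).act (label j) a (quot j x)

/-- The edges `mu → lam` of the branching diagram. -/
def Edge {r : ℕ} (mu : T.Vertex r) (lam : T.Vertex (r + 1)) : Prop :=
  ∃ (N : T.RestrictionFiltration r lam) (j : Fin N.length), N.label j = mu

/-- Standard tableaux of shape `lam`: directed paths on the branching diagram from level `0` (which
has just one vertex when `A_0 = R`) to `lam` at level `r`. -/
structure Tableau (r : ℕ) (lam : T.Vertex r) where
  vertex : ∀ i, i ≤ r → T.Vertex i
  edge : ∀ i (h : i + 1 ≤ r), T.Edge (vertex i (Nat.le_of_succ_le h)) (vertex (i + 1) h)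
  vertex_last : vertex r le_rfl = lam

end

end CellularTower

/-- A tower of diagram algebras over `R` with respect to the field of fractions `F`, together with
the choices that enter the construction of the Murphy bases. -/
structure DiagramTower (R : Type u) (F : Type uF) (A : ℕ → Type v) [CommRing R] [Field F]
    [Algebra R F] [∀ r, Ring (A r)] [∀ r, Algebra R (A r)]
    extends CellularTower.{u, v, w, w'} R A where
  /-- `A_0 = R` -/
  zero_eq : Function.Bijective (algebraMap R (A 0))
  /-- The algebras are cyclic cellular: `gen r lam` is a generator `δ_r(lam)` of the cell module. -/
  gen : ∀ r (lam : toCellularTower.Vertex r), (cell r).Cell lam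
  gen_cyclic : ∀ r lam (x : (cell r).Cell lam), ∃ a, (cell r).act lam a (gen r lam) = x
  /-- The bimodule isomorphism `α_lam : A^{⊵ lam} / A^{▷ lam} ≅ Δ(lam)^* ⊗ Δ(lam)`, recorded as a
  surjective map on `A^{⊵ lam}` with kernel `A^{▷ lam}`.  An element `x^* ⊗ y` is written `x ⊗ₜ y`,
  and `a x^* = (x a^*)^*`. -/
  alpha : ∀ r lam, (cell r).atLeast lam →ₗ[R] (cell r).Cell lam ⊗[R] (cell r).Cell lam
  alpha_surjective : ∀ r lam, Function.Surjective (alpha r lam)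
  alpha_ker : ∀ r lam (y : (cell r).atLeast lam),
    alpha r lam y = 0 ↔ (y : A r) ∈ (cell r).above lam
  alpha_bimodule : ∀ r lam (a b : A r) (y y' : (cell r).atLeast lam), (y' : A r) = a * y * b →
    alpha r lam y' =
      TensorProduct.map ((cell r).act lam ((cell r).inv a)) ((cell r).act lam b) (alpha r lam y)
  /-- The elements `m_lam`, lifts of `α_lam⁻¹(δ(lam)^* ⊗ δ(lam))`. -/
  m : ∀ r (lam : toCellularTower.Vertex r), (cell r).atLeast lam
  alpha_m : ∀ r lam, alpha r lam (m r lam) = gen r lam ⊗ₜ[R] gen r lam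
  /-- `m_lam^* = m_lam` -/
  m_inv : ∀ r lam, (cell r).inv (m r lam : A r) = m r lam
  /-- `A_r^F` is split semisimple. -/
  split_semisimple : ∀ r, IsSplitSemisimple F (F ⊗[R] A r)
  /-- The tower is restriction coherent. -/
  restriction_coherent : ∀ r (lam : toCellularTower.Vertex (r + 1)),
    Nonempty (toCellularTower.RestrictionFiltration r lam)
  /-- The branching factors `d_{mu → lam} ∈ A_{r+1}`; only the values at edges matter. -/
  d : ∀ r, toCellularTower.Vertex r → toCellularTower.Vertex (r + 1) → A (r + 1)
  /-- The branching factors come from an order preserving cell filtration of the restriction of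
  `Δ_{r+1}(lam)`: the element `δ(lam) d_{mu → lam}` (that is, `m_lam d_{mu → lam} + A^{▷ lam}`)
  lifts the generator `δ(mu)` of the corresponding quotient. -/
  d_spec : ∀ r (lam : toCellularTower.Vertex (r + 1)),
    ∃ N : toCellularTower.RestrictionFiltration r lam, ∀ j : Fin N.length,
      ∃ h : (cell (r + 1)).act lam (d r (N.label j) lam) (gen (r + 1) lam) ∈ N.N j.succ,
        N.quot j ⟨_, h⟩ = gen r (N.label j)
  /-- There are `u`-branching factors with `m_lam d_{mu → lam} = (u_{mu → lam})^* m_mu`. -/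
  compatibility : ∀ r (mu : toCellularTower.Vertex r) (lam : toCellularTower.Vertex (r + 1)),
    toCellularTower.Edge mu lam → ∃ x : A (r + 1),
      (m (r + 1) lam : A (r + 1)) * d r mu lam =
        (cell (r + 1)).inv x * toCellularTower.incl r (m r mu : A r)

namespace DiagramTower

section

variable {R : Type u} {F : Type uF} {A : ℕ → Type v} [CommRing R] [Field F] [Algebra R F]
  [∀ r, Ring (A r)] [∀ r, Algebra R (A r)] (T : DiagramTower.{u, uF, v, w, w'} R F A)

/-- The product `d_{t(s-1) → t(s)} ⋯ d_{t(0) → t(1)} ∈ A_s` along the first `s` edges of `t`. -/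
def dProd {r : ℕ} {lam : T.Vertex r} (t : T.Tableau r lam) : ∀ s, s ≤ r → A s
  | 0, _ => 1
  | s + 1, h =>
    T.d s (t.vertex s (Nat.le_of_succ_le h)) (t.vertex (s + 1) h) *
      T.incl s (dProd t s (Nat.le_of_succ_le h))

/-- The Murphy basis element `m_t = δ(lam) d_t` of `Δ_r(lam)`, i.e. `m_lam d_t + A^{▷ lam}` under
the identification of `Δ_r(lam)` with `(m_lam A + A^{▷ lam}) / A^{▷ lam}` which sends
`δ(lam) a` to `m_lam a + A^{▷ lam}`. -/
noncomputable def murphy {r : ℕ} {lam : T.Vertex r} (t : T.Tableau r lam) :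
    (T.cell r).Cell lam :=
  (T.cell r).act lam (T.dProd t r le_rfl) (T.gen r lam)

/-- The inclusion `A_r^F → A_{r+1}^F`. -/
noncomputable def inclF (r : ℕ) : F ⊗[R] A r →ₐ[F] F ⊗[R] A (r + 1) :=
  Algebra.TensorProduct.map (AlgHom.id F F) (T.incl r)

/-- The minimal central idempotent `z_lam` of `A_r^F` attached to `lam`: the one that acts as the
identity on `Δ_r^F(lam)`. -/
noncomputable def centralIdem {r : ℕ} (lam : T.Vertex r) : F ⊗[R] A r :=
  Classical.epsilon fun z =>
    IsMinimalCentralIdempotent z ∧ ∀ x, (T.cell r).actF F lam z x = x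

/-- The product `z_{t(1)} ⋯ z_{t(s)} ∈ A_s^F`. -/
noncomputable def gzProd {r : ℕ} {lam : T.Vertex r} (t : T.Tableau r lam) :
    ∀ s, s ≤ r → F ⊗[R] A s
  | 0, _ => 1
  | s + 1, h =>
    T.inclF s (gzProd t s (Nat.le_of_succ_le h)) * T.centralIdem (t.vertex (s + 1) h)

/-- The Gelfand–Zeitlin idempotent `F_t ∈ A_r^F`. -/
noncomputable def gzIdem {r : ℕ} {lam : T.Vertex r} (t : T.Tableau r lam) : F ⊗[R] A r :=
  T.gzProd t r le_rfl

/-- The seminormal basis element `f_t = m_t F_t` of `Δ_r^F(lam)`. -/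
noncomputable def seminormal {r : ℕ} {lam : T.Vertex r} (t : T.Tableau r lam) :
    (T.cell r).CellF F lam :=
  (T.cell r).actF F lam (T.gzIdem t) ((T.cell r).toCellF F lam (T.murphy t))

/-- `L_1 + ⋯ + L_r ∈ A_r` -/
def jmSum (L : ∀ r, A r) : ∀ r, A r
  | 0 => 0
  | r + 1 => T.incl r (jmSum L r) + L (r + 1)

/-- `L_1 ⋯ L_r ∈ A_r` -/
def jmProd (L : ∀ r, A r) : ∀ r, A r
  | 0 => 1
  | r + 1 => T.incl r (jmProd L r) * L (r + 1)

/-- `L_1, L_2, …` is an additive family of Jucys–Murphy elements, with central scalars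
`dd r lam = d(lam)`.  The value `L 0` plays no role. -/
structure IsAdditiveJM (L : ∀ r, A r) (dd : ∀ r, T.Vertex r → R) : Prop where
  invariant : ∀ r, (T.cell (r + 1)).inv (L (r + 1)) = L (r + 1)
  commute : ∀ r (a : A r), Commute (L (r + 1)) (T.incl r a)
  scalar : ∀ r (lam : T.Vertex (r + 1)) (x : (T.cell (r + 1)).Cell lam),
    (T.cell (r + 1)).act lam (T.jmSum L (r + 1)) x = dd (r + 1) lam • x
  scalar_zero : ∀ lam : T.Vertex 0, dd 0 lam = 0

/-- `L_1, L_2, …` is a multiplicative family of Jucys–Murphy elements, with central scalars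
`dd r lam = d(lam)`.  The value `L 0` plays no role. -/
structure IsMultiplicativeJM (L : ∀ r, A r) (dd : ∀ r, T.Vertex r → R) : Prop where
  isUnit : ∀ r, IsUnit (L (r + 1))
  invariant : ∀ r, (T.cell (r + 1)).inv (L (r + 1)) = L (r + 1)
  commute : ∀ r (a : A r), Commute (L (r + 1)) (T.incl r a)
  scalar : ∀ r (lam : T.Vertex (r + 1)) (x : (T.cell (r + 1)).Cell lam),
    (T.cell (r + 1)).act lam (T.jmProd L (r + 1)) x = dd (r + 1) lam • x
  scalar_zero : ∀ lam : T.Vertex 0, dd 0 lam = 1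

/-- The elements `L_i` act diagonally on the seminormal bases, with `f_t L_i = κ f_t` where
`κ = kappa (i - 1) (t(i-1)) (t(i))`. -/
def ActsDiagonally (L : ∀ r, A r)
    (kappa : ∀ r, T.Vertex r → T.Vertex (r + 1) → R) : Prop :=
  ∀ (r : ℕ) (lam : T.Vertex r) (t : T.Tableau r lam) (i : ℕ) (hi : i + 1 ≤ r),
    (T.cell r).actF F lam (1 ⊗ₜ[R] T.inclLE hi (L (i + 1))) (T.seminormal t) =
      kappa i (t.vertex i (Nat.le_of_succ_le hi)) (t.vertex (i + 1) hi) • T.seminormal t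

end

end DiagramTower

/-! Over `F`, the cell representations of $A_r^{\mathbb F}$ assemble into an isomorphism onto a
product of full matrix algebras (`repAll`). An element acting as zero on every cell module is
nilpotent, since right multiplication by it pushes each cell strictly up the finite poset; so the
kernel is a nil ideal, hence zero by semisimplicity. Surjectivity then follows by counting
dimensions. Under this isomorphism $z_\lambda$ is the identity matrix in the component $\lambda$ and
zero elsewhere (`centralIdem_spec`).

The basis statement is an induction on $r$. As $z_\lambda$ acts as the identity on $\Delta^{\mathbb
F}(\lambda)$, the seminormal vector of a path $\mathsf t\to\lambda$ is
$\delta(\lambda)d_{\mu\to\lambda}$ acted on by $d_{\mathsf t}F_{\mathsf t}\in A_r^{\mathbb F}$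
(`seminormal_extend`). It therefore lies over $\delta(\mu)d_{\mathsf t}F_{\mathsf t}=f_{\mathsf t}$
in the subquotient $\Delta^{\mathbb F}(\mu)$ of the restriction. Climbing the filtration gives
spanning; since its labels are distinct and independent of the filtration
(`exists_label_eq_of_edge`), the paths are as many as the dimension (`sum_card_label`).

For the Jucys–Murphy elements, $z_{\mathsf t(s)}$ turns $L_1+\cdots+L_s$ or $L_1\cdots L_s$ into the
scalar $d(\mathsf t(s))$, and the later factors of $F_{\mathsf t}$ are central at their levels, so
the scalar survives (`gzProd_mul_inclLE`). Comparing the levels $s$ and $s+1$ isolates $L_{s+1}$. -/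

/-- An element of a split semisimple algebra which generates a nil left ideal is zero. -/
lemma IsSplitSemisimple.eq_zero_of_isNilpotent_mul {F B : Type*} [Field F] [Ring B] [Algebra F B]
    (h : IsSplitSemisimple F B) {b : B} (hb : ∀ y, IsNilpotent (y * b)) : b = 0 := by
  obtain ⟨n, k, ⟨e⟩⟩ := h
  apply e.injective
  rw [map_zero]
  funext i
  ext p q
  -- The trace of $E_{qp}X$ is the entry $X_{pq}$, and a nilpotent matrix over a field has trace
  -- zero.
  have h1 : IsNilpotent (Matrix.single q p (1 : F) * e b i) := by
    have h2 := ((hb (e.symm (Pi.single i (Matrix.single q p 1)))).map e).map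
      (Pi.evalRingHom (fun i => Matrix (Fin (k i)) (Fin (k i)) F) i)
    simpa using h2
  have h3 := (Matrix.isNilpotent_trace_of_isNilpotent h1).eq_zero
  simpa [Matrix.trace_single_mul] using h3

/-! ### Cell representations over `F` and minimal central idempotents -/

namespace CellDatum

variable {R : Type u} {A : Type v} [CommRing R] [Ring A] [Algebra R A]
  (C : CellDatum.{u, v, w, w'} R A) (F : Type uF) [Field F] [Algebra R F]

lemma rep_apply (lam : C.Lam) (a : A) (s t : C.M lam) : C.rep lam a s t = C.coeff lam a s t :=
  rfl

lemma act_mul (lam : C.Lam) (a b : A) (x : C.Cell lam) :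
    C.act lam (a * b) x = C.act lam b (C.act lam a x) := by
  simp [act, Matrix.vecMul_vecMul]

lemma actF_mul (lam : C.Lam) (a b : F ⊗[R] A) (x : C.CellF F lam) :
    C.actF F lam (a * b) x = C.actF F lam b (C.actF F lam a x) := by
  simp [actF, Matrix.vecMul_vecMul]

lemma actF_one (lam : C.Lam) (x : C.CellF F lam) : C.actF F lam 1 x = x := by
  simp [actF]

lemma actF_zero (lam : C.Lam) (x : C.CellF F lam) : C.actF F lam 0 x = 0 := by
  simp [actF]

lemma actF_add (lam : C.Lam) (a b : F ⊗[R] A) (x : C.CellF F lam) :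
    C.actF F lam (a + b) x = C.actF F lam a x + C.actF F lam b x := by
  simp [actF]

lemma actF_smul (lam : C.Lam) (k : F) (a : F ⊗[R] A) (x : C.CellF F lam) :
    C.actF F lam (k • a) x = k • C.actF F lam a x := by
  simp [actF]

lemma repF_one_tmul (lam : C.Lam) (a : A) :
    C.repF F lam (1 ⊗ₜ a) = (C.rep lam a).map (algebraMap R F) := by
  refine (Algebra.TensorProduct.lift_tmul _ _ _ 1 a).trans ?_
  rw [map_one, one_mul]
  rfl

/-- The inclusion `Δ(lam) → Δ^F(lam)` as a linear map. -/
def toCellFₗ (lam : C.Lam) : C.Cell lam →ₗ[R] C.CellF F lam :=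
  (Algebra.linearMap R F).compLeft _

lemma toCellFₗ_apply (lam : C.Lam) (x : C.Cell lam) : C.toCellFₗ F lam x = C.toCellF F lam x :=
  rfl

lemma actF_toCellFₗ (lam : C.Lam) (a : A) (x : C.Cell lam) :
    C.actF F lam (1 ⊗ₜ a) (C.toCellFₗ F lam x) = C.toCellFₗ F lam (C.act lam a x) := by
  ext t
  simp only [actF, act, Matrix.vecMulLinear_apply, repF_one_tmul]
  exact (RingHom.map_vecMul (algebraMap R F) (C.rep lam a) x t).symm

lemma toCellFₗ_injective [FaithfulSMul R F] (lam : C.Lam) :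
    Function.Injective (C.toCellFₗ F lam) := by
  intro x y h
  ext t
  exact FaithfulSMul.algebraMap_injective R F (congrFun h t)

/-- The vectors of `Δ^F(lam)` are spanned by those of `Δ(lam)`. -/
lemma span_range_toCellFₗ (lam : C.Lam) :
    Submodule.span F (Set.range (C.toCellFₗ F lam)) = ⊤ := by
  classical
  rw [eq_top_iff, ← (Pi.basisFun F (C.M lam)).span_eq]
  apply Submodule.span_mono
  rintro _ ⟨t, rfl⟩
  refine ⟨Pi.single t 1, ?_⟩
  ext s
  by_cases h : s = t
  · subst h; simp [toCellFₗ]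
  · simp [toCellFₗ, h]

lemma basis_mul_sub_mem (lam : C.Lam) (s t : C.M lam) (b : F ⊗[R] A) :
    C.c.baseChange F ⟨lam, s, t⟩ * b - ∑ v, C.repF F lam b t v • C.c.baseChange F ⟨lam, s, v⟩ ∈
      Submodule.span F {y | ∃ (mu : C.Lam) (p : C.M mu × C.M mu), lam < mu ∧
        y = C.c.baseChange F ⟨mu, p⟩} := by
  set S := Submodule.span F {y | ∃ (mu : C.Lam) (p : C.M mu × C.M mu), lam < mu ∧
        y = C.c.baseChange F ⟨mu, p⟩}
  induction b using TensorProduct.induction_on with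
  | zero => simp
  | add x y hx hy =>
    simp only [mul_add, map_add, Matrix.add_apply, add_smul, Finset.sum_add_distrib]
    rw [add_sub_add_comm]
    exact S.add_mem hx hy
  | tmul k a =>
    have hka : k ⊗ₜ[R] a = k • ((1 : F) ⊗ₜ[R] a) := by simp [TensorProduct.smul_tmul']
    have key : ∀ y ∈ C.above lam, (1 : F) ⊗ₜ[R] y ∈ S := by
      intro y hy
      unfold above at hy
      induction hy using Submodule.span_induction with
      | mem y hy =>
        obtain ⟨mu, p, hlt, rfl⟩ := hy
        exact Submodule.subset_span ⟨mu, p, hlt, by simp⟩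
      | zero => simp
      | add x y _ _ hx hy => rw [TensorProduct.tmul_add]; exact S.add_mem hx hy
      | smul r x _ hx =>
        rw [TensorProduct.tmul_smul, ← algebraMap_smul F r]
        exact S.smul_mem _ hx
    have h := S.smul_mem k (key _ (C.coeff_spec lam a s t))
    rw [hka]
    convert h using 1
    simp only [map_smul, mul_smul_comm, Matrix.smul_apply, smul_assoc, ← Finset.smul_sum,
      ← smul_sub, TensorProduct.tmul_sub, TensorProduct.tmul_sum, repF_one_tmul, Matrix.map_apply,
      rep_apply, Module.Basis.baseChange_apply, Algebra.TensorProduct.tmul_mul_tmul, one_mul,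
      TensorProduct.tmul_smul, algebraMap_smul]

/-- The elements annihilated on the right by some power of `b` form a subspace `S`; it contains the
whole cellular basis, hence `1`. -/
lemma isNilpotent_of_repF_eq_zero (b : F ⊗[R] A) (hb : ∀ lam, C.repF F lam b = 0) :
    IsNilpotent b := by
  let S : Submodule F (F ⊗[R] A) :=
    { carrier := {y | ∃ n, y * b ^ n = 0}
      zero_mem' := ⟨0, by simp⟩
      add_mem' := by
        rintro x y ⟨m, hm⟩ ⟨n, hn⟩
        refine ⟨m + n, ?_⟩
        rw [add_mul, pow_add, ← mul_assoc, hm, zero_mul, zero_add, ← pow_add, add_comm, pow_add,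
          ← mul_assoc, hn, zero_mul]
      smul_mem' := by
        rintro k x ⟨m, hm⟩
        exact ⟨m, by rw [smul_mul_assoc, hm, smul_zero]⟩ }
  have hS : ∀ (lam : C.Lam) (p : C.M lam × C.M lam), C.c.baseChange F ⟨lam, p⟩ ∈ S := by
    intro lam
    -- Induction from the top of the poset: as `b` acts by zero on the cell module, $c_{st}b$ lies
    -- in the span of strictly larger cells, already inside `S`.
    induction lam using (wellFounded_gt (α := C.Lam)).induction with
    | _ lam ih =>
      rintro ⟨s, t⟩
      have h := C.basis_mul_sub_mem F lam s t b
      simp only [hb, Matrix.zero_apply, zero_smul, Finset.sum_const_zero, sub_zero] at h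
      have h2 : C.c.baseChange F ⟨lam, s, t⟩ * b ∈ S := by
        refine Submodule.span_le.2 ?_ h
        rintro _ ⟨mu, p, hlt, rfl⟩
        exact ih mu hlt p
      obtain ⟨n, hn⟩ := h2
      exact ⟨n + 1, by rw [pow_succ', ← mul_assoc, hn]⟩
  have h1 : (1 : F ⊗[R] A) ∈ S := by
    have : (⊤ : Submodule F (F ⊗[R] A)) ≤ S := by
      rw [← (C.c.baseChange F).span_eq, Submodule.span_le]
      rintro _ ⟨⟨lam, p⟩, rfl⟩
      exact hS lam p
    exact this trivial
  obtain ⟨n, hn⟩ := h1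
  exact ⟨n, by simpa using hn⟩

/-- The product of the cell representations of `A^F`. -/
noncomputable def repAll : F ⊗[R] A →ₐ[F] (∀ lam : C.Lam, Matrix (C.M lam) (C.M lam) F) :=
  AlgHom.pi fun lam => C.repF F lam

lemma repAll_apply (b : F ⊗[R] A) (lam : C.Lam) : C.repAll F b lam = C.repF F lam b := rfl

variable {F}

lemma repAll_injective (h : IsSplitSemisimple F (F ⊗[R] A)) :
    Function.Injective (C.repAll F) := by
  rw [injective_iff_map_eq_zero]
  intro b hb
  refine h.eq_zero_of_isNilpotent_mul fun y => C.isNilpotent_of_repF_eq_zero F _ fun lam => ?_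
  rw [map_mul, ← C.repAll_apply F b, hb, Pi.zero_apply, mul_zero]

/-- Both sides have dimension $\sum_\lambda |M(\lambda)|^2$. -/
lemma repAll_surjective (h : IsSplitSemisimple F (F ⊗[R] A)) :
    Function.Surjective (C.repAll F) := by
  classical
  have := Fintype.ofFinite C.Lam
  have : Module.Finite F (F ⊗[R] A) := Module.Finite.of_basis (C.c.baseChange F)
  refine (LinearMap.injective_iff_surjective_of_finrank_eq_finrank
    (f := (C.repAll F).toLinearMap) ?_).1 (C.repAll_injective h)
  rw [Module.finrank_eq_card_basis (C.c.baseChange F), Module.finrank_pi_fintype]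
  simp [Module.finrank_matrix]

lemma exists_repF_eq (h : IsSplitSemisimple F (F ⊗[R] A)) (lam : C.Lam) :
    ∃ z : F ⊗[R] A, C.repF F lam z = 1 ∧ ∀ mu, mu ≠ lam → C.repF F mu z = 0 := by
  classical
  obtain ⟨z, hz⟩ := C.repAll_surjective h (Pi.single lam 1)
  refine ⟨z, ?_, fun mu hmu => ?_⟩
  · rw [← repAll_apply, hz, Pi.single_eq_same]
  · rw [← repAll_apply, hz, Pi.single_eq_of_ne hmu]

/-- Minimality: a central idempotent below `z` lives in the component `lam`, where surjectivity of
`repAll` makes it central in the full matrix ring, hence an idempotent scalar, 0 or 1. -/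
lemma isMinimalCentralIdempotent (h : IsSplitSemisimple F (F ⊗[R] A)) {lam : C.Lam}
    {z : F ⊗[R] A} (h1 : C.repF F lam z = 1) (h0 : ∀ mu, mu ≠ lam → C.repF F mu z = 0) :
    IsMinimalCentralIdempotent z where
  central := by
    rw [Semigroup.mem_center_iff]
    intro b
    apply C.repAll_injective h
    funext mu
    rw [repAll_apply, repAll_apply, map_mul, map_mul]
    by_cases hmu : mu = lam
    · subst hmu; rw [h1, mul_one, one_mul]
    · rw [h0 mu hmu, mul_zero, zero_mul]
  idem := by
    apply C.repAll_injective h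
    funext mu
    rw [repAll_apply, repAll_apply, map_mul]
    by_cases hmu : mu = lam
    · subst hmu; rw [h1, mul_one]
    · rw [h0 mu hmu, mul_zero]
  ne_zero := by
    rintro rfl
    rw [map_zero] at h1
    exact zero_ne_one h1
  minimal := by
    intro e hc he hez
    have he0 : ∀ mu, mu ≠ lam → C.repF F mu e = 0 := fun mu hmu => by
      rw [← hez, map_mul, h0 mu hmu, mul_zero]
    have hmem : C.repF F lam e ∈ Set.center (Matrix (C.M lam) (C.M lam) F) := by
      classical
      rw [Semigroup.mem_center_iff] at hc ⊢
      intro g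
      obtain ⟨b, hb⟩ := C.repAll_surjective h (Pi.single lam g)
      have hb' : C.repF F lam b = g := by rw [← repAll_apply, hb, Pi.single_eq_same]
      rw [← hb', ← map_mul, ← map_mul, hc]
    rw [Matrix.center_eq_range] at hmem
    obtain ⟨k, hk⟩ := hmem
    have hkk : k * k = k := by
      have h2 := congrArg (C.repF F lam) he
      rw [map_mul, ← hk, ← map_mul] at h2
      exact Matrix.scalar_inj.1 h2
    rcases IsIdempotentElem.iff_eq_zero_or_one.1 hkk with rfl | rfl
    · left
      apply C.repAll_injective h
      funext mu
      rw [repAll_apply, map_zero, Pi.zero_apply]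
      by_cases hmu : mu = lam
      · subst hmu; rw [← hk, map_zero]
      · exact he0 mu hmu
    · right
      apply C.repAll_injective h
      funext mu
      rw [repAll_apply, repAll_apply]
      by_cases hmu : mu = lam
      · subst hmu; rw [h1, ← hk, map_one]
      · rw [he0 mu hmu, h0 mu hmu]

/-- A minimal central idempotent which acts as the identity on `Δ^F(lam)` acts as zero on the other
cell modules. -/
lemma repF_of_isMinimalCentralIdempotent (h : IsSplitSemisimple F (F ⊗[R] A)) {lam : C.Lam}
    {z : F ⊗[R] A} (hz : IsMinimalCentralIdempotent z) (hact : ∀ x, C.actF F lam z x = x) :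
    C.repF F lam z = 1 ∧ ∀ mu, mu ≠ lam → C.repF F mu z = 0 := by
  obtain ⟨e, he1, he0⟩ := C.exists_repF_eq h lam
  have hz1 : C.repF F lam z = 1 := by
    apply Matrix.ext_of_single_vecMul
    intro i
    rw [Matrix.vecMul_one]
    exact hact _
  -- The idempotent `e` of the component `lam` lies below `z` and is nonzero, so minimality of `z`
  -- forces `e = z`.
  have hmin := C.isMinimalCentralIdempotent h he1 he0
  have hez : e * z = e := by
    apply C.repAll_injective h
    funext mu
    rw [repAll_apply, repAll_apply, map_mul]
    by_cases hmu : mu = lam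
    · subst hmu; rw [hz1, mul_one]
    · rw [he0 mu hmu, zero_mul]
  rcases hz.minimal e hmin.central hmin.idem hez with h2 | h2
  · exact absurd h2 hmin.ne_zero
  · exact h2 ▸ ⟨he1, he0⟩

end CellDatum

/-! ### Restriction filtrations after extension of scalars -/

namespace DiagramTower

variable {R : Type u} {F : Type uF} {A : ℕ → Type v} [CommRing R] [Field F] [Algebra R F]
  [∀ r, Ring (A r)] [∀ r, Algebra R (A r)] (T : DiagramTower.{u, uF, v, w, w'} R F A)

/-- The defining condition of `centralIdem` is satisfiable, and any solution has prescribed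
components. -/
lemma centralIdem_spec {r : ℕ} (lam : T.Vertex r) :
    (T.cell r).repF F lam (T.centralIdem lam) = 1 ∧
      ∀ mu, mu ≠ lam → (T.cell r).repF F mu (T.centralIdem lam) = 0 := by
  have h : ∃ z, IsMinimalCentralIdempotent z ∧ ∀ x, (T.cell r).actF F lam z x = x := by
    obtain ⟨z, h1, h0⟩ := (T.cell r).exists_repF_eq (T.split_semisimple r) lam
    refine ⟨z, (T.cell r).isMinimalCentralIdempotent (T.split_semisimple r) h1 h0, fun x => ?_⟩
    simp [CellDatum.actF, h1]
  obtain ⟨h1, h2⟩ := Classical.epsilon_spec h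
  exact (T.cell r).repF_of_isMinimalCentralIdempotent (T.split_semisimple r) h1 h2

lemma actF_centralIdem_self {r : ℕ} (lam : T.Vertex r) (x : (T.cell r).CellF F lam) :
    (T.cell r).actF F lam (T.centralIdem lam) x = x := by
  simp [CellDatum.actF, (T.centralIdem_spec lam).1]

lemma actF_centralIdem_of_ne {r : ℕ} {lam mu : T.Vertex r} (h : mu ≠ lam)
    (x : (T.cell r).CellF F mu) : (T.cell r).actF F mu (T.centralIdem lam) x = 0 := by
  simp [CellDatum.actF, (T.centralIdem_spec lam).2 mu h]

lemma isMinimalCentralIdempotent_centralIdem {r : ℕ} (lam : T.Vertex r) :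
    IsMinimalCentralIdempotent (T.centralIdem lam) :=
  (T.cell r).isMinimalCentralIdempotent (T.split_semisimple r) (T.centralIdem_spec lam).1
    (T.centralIdem_spec lam).2

lemma inclF_one_tmul (r : ℕ) (a : A r) :
    T.inclF r ((1 : F) ⊗ₜ[R] a) = 1 ⊗ₜ[R] T.incl r a := by
  simp [inclF]

variable {T} {r : ℕ} {lam : T.Vertex (r + 1)} (N : T.toCellularTower.RestrictionFiltration r lam)

/-- The `F`-span of the graph of the quotient map `N_{j+1} → Δ(label j)`. -/
def graphF (j : Fin N.length) :
    Submodule F ((T.cell (r + 1)).CellF F lam × (T.cell r).CellF F (N.label j)) :=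
  Submodule.span F (Set.range fun x : N.N j.succ =>
    ((T.cell (r + 1)).toCellFₗ F lam x, (T.cell r).toCellFₗ F (N.label j) (N.quot j x)))

/-- The `F`-span of the `k`-th step of the filtration. -/
def stepF (k : Fin (N.length + 1)) : Submodule F ((T.cell (r + 1)).CellF F lam) :=
  Submodule.span F ((T.cell (r + 1)).toCellFₗ F lam '' N.N k)

lemma mk_mem_graphF (j : Fin N.length) (x : N.N j.succ) :
    ((T.cell (r + 1)).toCellFₗ F lam x, (T.cell r).toCellFₗ F (N.label j) (N.quot j x)) ∈
      graphF N j :=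
  Submodule.subset_span ⟨x, rfl⟩

lemma stepF_last : stepF N (Fin.last _) = ⊤ := by
  rw [stepF, N.N_last, Submodule.top_coe, Set.image_univ, CellDatum.span_range_toCellFₗ]

lemma stepF_zero : stepF N 0 = ⊥ := by
  rw [stepF, N.N_zero, Submodule.bot_coe, Set.image_singleton, map_zero,
    Submodule.span_zero_singleton]

lemma graphF_act (j : Fin N.length) (b : F ⊗[R] A r)
    {p : (T.cell (r + 1)).CellF F lam × (T.cell r).CellF F (N.label j)} (hp : p ∈ graphF N j) :
    ((T.cell (r + 1)).actF F lam (T.inclF r b) p.1, (T.cell r).actF F (N.label j) b p.2) ∈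
      graphF N j := by
  induction b using TensorProduct.induction_on with
  | zero =>
    simp only [map_zero, CellDatum.actF_zero]
    exact (graphF N j).zero_mem
  | add x y hx hy =>
    simp only [map_add, CellDatum.actF_add]
    exact (graphF N j).add_mem hx hy
  | tmul k a =>
    have hka : k ⊗ₜ[R] a = k • ((1 : F) ⊗ₜ[R] a) := by simp [TensorProduct.smul_tmul']
    rw [hka, map_smul, CellDatum.actF_smul, CellDatum.actF_smul, inclF_one_tmul]
    rw [← Prod.smul_mk]
    apply (graphF N j).smul_mem k
    unfold graphF at hp
    induction hp using Submodule.span_induction with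
    | mem p hp =>
      obtain ⟨x, rfl⟩ := hp
      simp only [CellDatum.actF_toCellFₗ]
      rw [← N.quot_act]
      exact mk_mem_graphF N j ⟨_, N.N_act j.succ a x x.2⟩
    | zero =>
      simp only [Prod.fst_zero, Prod.snd_zero, map_zero]
      exact (graphF N j).zero_mem
    | add x y _ _ hx hy =>
      simp only [Prod.fst_add, Prod.snd_add, map_add]
      exact (graphF N j).add_mem hx hy
    | smul c x _ hx =>
      simp only [Prod.smul_fst, Prod.smul_snd, map_smul]
      exact (graphF N j).smul_mem c hx

section

variable [IsDomain R] [IsFractionRing R F]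

/-- Clearing denominators in the span of the graph of a quotient map. -/
lemma exists_smul_eq_of_mem_graphF (j : Fin N.length)
    {p : (T.cell (r + 1)).CellF F lam × (T.cell r).CellF F (N.label j)} (hp : p ∈ graphF N j) :
    ∃ c : R, c ≠ 0 ∧ ∃ x : N.N j.succ, c • p = ((T.cell (r + 1)).toCellFₗ F lam x,
      (T.cell r).toCellFₗ F (N.label j) (N.quot j x)) := by
  unfold graphF at hp
  induction hp using Submodule.span_induction with
  | mem p hp =>
    obtain ⟨x, rfl⟩ := hp
    exact ⟨1, one_ne_zero, x, by simp⟩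
  | zero => exact ⟨1, one_ne_zero, 0, by simp only [smul_zero, Submodule.coe_zero, map_zero]; rfl⟩
  | add p q _ _ hp hq =>
    obtain ⟨c, hc, x, hx⟩ := hp
    obtain ⟨d, hd, y, hy⟩ := hq
    refine ⟨c * d, mul_ne_zero hc hd, d • x + c • y, ?_⟩
    rw [smul_add, mul_smul, mul_smul, smul_comm c d p, hx, hy]
    simp
  | smul k p _ hp =>
    obtain ⟨c, hc, x, hx⟩ := hp
    obtain ⟨⟨n, d⟩, hnd⟩ := IsLocalization.surj (nonZeroDivisors R) k
    refine ⟨d * c, mul_ne_zero (nonZeroDivisors.coe_ne_zero d) hc, n • x, ?_⟩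
    have h1 : ((d : R) * c) • k • p = n • c • p := by
      rw [← algebraMap_smul F ((d : R) * c), ← algebraMap_smul F n, ← algebraMap_smul F c p,
        smul_smul, smul_smul, ← hnd, map_mul]
      congr 1
      ring
    rw [h1, hx]
    simp

/-- After clearing denominators this is `quot_ker` over `R`. With `eq_zero_of_mem_graphF` it makes
`graphF` the graph of an `F`-linear map on `stepF N j.succ` with kernel `stepF N j.castSucc`. -/
lemma mem_stepF_of_mem_graphF (j : Fin N.length) {v : (T.cell (r + 1)).CellF F lam}
    (hv : (v, 0) ∈ graphF N j) : v ∈ stepF N j.castSucc := by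
  obtain ⟨c, hc, x, hx⟩ := exists_smul_eq_of_mem_graphF N j hv
  rw [Prod.smul_mk, smul_zero, Prod.mk.injEq] at hx
  have h0 : N.quot j x = 0 :=
    (T.cell r).toCellFₗ_injective F _ (by rw [← hx.2, map_zero])
  have hmem : (T.cell (r + 1)).toCellFₗ F lam x ∈ stepF N j.castSucc :=
    Submodule.subset_span ⟨x, (N.quot_ker j x).1 h0, rfl⟩
  rw [← hx.1, ← algebraMap_smul F c] at hmem
  refine ((stepF N j.castSucc).smul_mem_iff ?_).1 hmem
  simpa using hc

lemma eq_zero_of_mem_graphF (j : Fin N.length) {y : (T.cell r).CellF F (N.label j)}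
    (hy : (0, y) ∈ graphF N j) : y = 0 := by
  obtain ⟨c, hc, x, hx⟩ := exists_smul_eq_of_mem_graphF N j hy
  rw [Prod.smul_mk, smul_zero, Prod.mk.injEq] at hx
  have h0 : x = 0 := by
    apply Subtype.ext
    exact (T.cell (r + 1)).toCellFₗ_injective F _ (by rw [← hx.1]; simp)
  rw [h0, map_zero, map_zero, ← algebraMap_smul F c] at hx
  exact (smul_eq_zero.1 hx.2).resolve_left (by simpa using hc)

/-- The cell modules occurring in a filtration of the restriction of `Δ(lam)` do not depend on the
filtration. -/
lemma exists_label_eq_of_edge {mu : T.Vertex r} (h : T.toCellularTower.Edge mu lam) :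
    ∃ j, N.label j = mu := by
  by_contra! hne
  set z := T.inclF r (T.centralIdem mu) with hz
  have hzz : z * z = z := by
    rw [hz, ← map_mul, (T.isMinimalCentralIdempotent_centralIdem mu).idem]
  -- If `mu` is not a label, `z` kills every subquotient, so it sends each step into the previous
  -- one, which it kills by induction; idempotency then gives $xz=xzz=0$.
  have key : ∀ k, stepF N k ≤ LinearMap.ker ((T.cell (r + 1)).actF F lam z) := by
    intro k
    induction k using Fin.induction with
    | zero => rw [stepF_zero]; exact bot_le
    | succ j ih =>
      refine Submodule.span_le.2 ?_
      rintro _ ⟨x, hx, rfl⟩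
      have h1 := graphF_act N j (T.centralIdem mu) (mk_mem_graphF N j ⟨x, hx⟩)
      rw [T.actF_centralIdem_of_ne (hne j)] at h1
      have h2 := ih (mem_stepF_of_mem_graphF N j h1)
      rw [LinearMap.mem_ker, ← CellDatum.actF_mul, hzz] at h2
      exact h2
  have hzero : ∀ x, (T.cell (r + 1)).actF F lam z x = 0 := fun x =>
    key (Fin.last _) (by rw [stepF_last]; trivial)
  obtain ⟨N', j, rfl⟩ := h
  -- The all-ones vector is nonzero because the index set is nonempty; $z_\mu$ fixes it in the
  -- subquotient but kills its lift.
  obtain ⟨x, hx⟩ := N'.quot_surjective j (fun _ => 1)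
  have h1 := graphF_act N' j (T.centralIdem (N'.label j)) (mk_mem_graphF N' j x)
  rw [T.actF_centralIdem_self, hzero] at h1
  have h2 := eq_zero_of_mem_graphF N' j h1
  rw [← map_zero ((T.cell r).toCellFₗ F (N'.label j)), hx] at h2
  exact one_ne_zero (congrFun ((T.cell r).toCellFₗ_injective F _ h2)
    (Classical.arbitrary ((T.cell r).M (N'.label j))))

end

lemma _root_.Fin.apply_last_eq_add_sum {α : Type*} [AddCommMonoid α] {n : ℕ} (g : Fin (n + 1) → α)
    (f : Fin n → α) (h : ∀ j, g j.succ = g j.castSucc + f j) :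
    g (Fin.last n) = g 0 + ∑ j, f j := by
  induction n with
  | zero => simp
  | succ n ih =>
    rw [Fin.sum_univ_castSucc, ← add_assoc, ← Fin.succ_last, h,
      ← Fin.castSucc_zero, ← ih (fun j => g j.castSucc) (fun j => f j.castSucc) fun j => by
        rw [← h j.castSucc, Fin.succ_castSucc]]

/-- Rank-nullity over a domain for the quotient map. Ranks are cardinals, so the telescoping is done
additively. -/
lemma rank_step_succ [IsDomain R] (j : Fin N.length) :
    Module.rank R (N.N j.succ) =
      Module.rank R (N.N j.castSucc) + Fintype.card ((T.cell r).M (N.label j)) := by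
  have h1 := LinearMap.rank_range_add_rank_ker (N.quot j)
  have h2 : LinearMap.ker (N.quot j) = (N.N j.castSucc).comap (N.N j.succ).subtype := by
    ext x
    exact N.quot_ker j x
  have h3 : N.N j.castSucc ≤ N.N j.succ := N.N_mono (Fin.castSucc_lt_succ).le
  rw [h2, (Submodule.comapSubtypeEquivOfLe h3).rank_eq, LinearMap.range_eq_top.2
    (N.quot_surjective j), rank_top, rank_fun'] at h1
  rw [← h1, add_comm]

/-- The rank of `Δ(lam)` is the sum of the ranks of the cell modules in the filtration. -/
lemma sum_card_label [IsDomain R] :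
    ∑ j, Fintype.card ((T.cell r).M (N.label j)) = Fintype.card ((T.cell (r + 1)).M lam) := by
  have h := Fin.apply_last_eq_add_sum (fun k => Module.rank R (N.N k)) _ (rank_step_succ N)
  rw [N.N_zero, N.N_last, rank_bot, zero_add, rank_top, rank_fun'] at h
  exact_mod_cast h.symm

end DiagramTower

/-! ### Paths in the branching diagram -/

namespace CellularTower

variable {R : Type u} {A : ℕ → Type v} [CommRing R] [∀ r, Ring (A r)] [∀ r, Algebra R (A r)]
  (T : CellularTower.{u, v, w, w'} R A)

lemma inclLE_self (r : ℕ) (a : A r) : T.inclLE le_rfl a = a := by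
  simp [inclLE, Nat.leRecOn_self]

lemma inclLE_succ {i r : ℕ} (h : i ≤ r) (a : A i) :
    T.inclLE (Nat.le_succ_of_le h) a = T.incl r (T.inclLE h a) := by
  simp [inclLE, Nat.leRecOn_succ h]

variable {T}

lemma Tableau.ext_vertex {r : ℕ} {lam : T.Vertex r} {t t' : T.Tableau r lam}
    (h : ∀ i hi, t.vertex i hi = t'.vertex i hi) : t = t' := by
  obtain ⟨v, _, _⟩ := t
  obtain ⟨v', _, _⟩ := t'
  obtain rfl : v = v' := funext fun i => funext fun hi => h i hi
  rfl

/-- The restriction of a standard tableau to its first `r` steps. -/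
def Tableau.restrict {r : ℕ} {lam : T.Vertex (r + 1)} (t : T.Tableau (r + 1) lam) :
    T.Tableau r (t.vertex r (Nat.le_succ r)) where
  vertex i h := t.vertex i (Nat.le_succ_of_le h)
  edge i h := t.edge i (Nat.le_succ_of_le h)
  vertex_last := rfl

/-- The extension of a standard tableau by an edge. -/
def Tableau.extend {r : ℕ} {mu : T.Vertex r} {lam : T.Vertex (r + 1)} (t : T.Tableau r mu)
    (e : T.Edge mu lam) : T.Tableau (r + 1) lam where
  vertex i h := if h' : i ≤ r then t.vertex i h' else
    (show i = r + 1 by omega) ▸ lam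
  edge i h := by
    by_cases h' : i + 1 ≤ r
    · rw [dif_pos h', dif_pos (Nat.le_of_succ_le h')]
      exact t.edge i h'
    · obtain rfl : i = r := by omega
      rw [dif_neg h', dif_pos le_rfl, t.vertex_last]
      exact e
  vertex_last := by simp

lemma Tableau.extend_vertex {r : ℕ} {mu : T.Vertex r} {lam : T.Vertex (r + 1)}
    (t : T.Tableau r mu) (e : T.Edge mu lam) (i : ℕ) (h : i ≤ r) :
    (t.extend e).vertex i (Nat.le_succ_of_le h) = t.vertex i h :=
  dif_pos h

lemma RestrictionFiltration.edge_label {r : ℕ} {lam : T.Vertex (r + 1)}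
    (N : T.RestrictionFiltration r lam) (j : Fin N.length) : T.Edge (N.label j) lam :=
  ⟨N, j, rfl⟩

/-- Extension of tableaux along the edges given by a filtration. -/
def RestrictionFiltration.extend {r : ℕ} {lam : T.Vertex (r + 1)}
    (N : T.RestrictionFiltration r lam) (p : Σ j : Fin N.length, T.Tableau r (N.label j)) :
    T.Tableau (r + 1) lam :=
  p.2.extend (N.edge_label p.1)

lemma RestrictionFiltration.label_injective {r : ℕ} {lam : T.Vertex (r + 1)}
    (N : T.RestrictionFiltration r lam) : Function.Injective N.label := by
  intro i j h
  by_contra hne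
  rcases lt_or_gt_of_ne hne with h1 | h1
  · exact (N.label_anti i j h1).ne' h
  · exact (N.label_anti j i h1).ne h

lemma RestrictionFiltration.extend_injective {r : ℕ} {lam : T.Vertex (r + 1)}
    (N : T.RestrictionFiltration r lam) : Function.Injective N.extend := by
  rintro ⟨i, t⟩ ⟨j, t'⟩ h
  have hv : ∀ k (hk : k ≤ r), t.vertex k hk = t'.vertex k hk := fun k hk => by
    have h1 := t.extend_vertex (N.edge_label i) k hk
    have h2 := t'.extend_vertex (N.edge_label j) k hk
    rw [← h1, ← h2]
    exact congrArg (fun s : T.Tableau (r + 1) lam => s.vertex k (Nat.le_succ_of_le hk)) h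
  -- The endpoint of the shorter path recovers the index, because the labels of a filtration are
  -- distinct.
  obtain rfl : i = j := N.label_injective (by rw [← t.vertex_last, hv, t'.vertex_last])
  rw [Tableau.ext_vertex hv]

lemma RestrictionFiltration.extend_surjective {r : ℕ} {lam : T.Vertex (r + 1)}
    (N : T.RestrictionFiltration r lam) (hN : ∀ mu, T.Edge mu lam → ∃ j, N.label j = mu) :
    Function.Surjective N.extend := by
  intro t
  have he := t.edge r le_rfl
  rw [t.vertex_last] at he
  obtain ⟨j, hj⟩ := hN _ he
  refine ⟨⟨j, ⟨t.restrict.vertex, t.restrict.edge, hj.symm⟩⟩, Tableau.ext_vertex fun i hi => ?_⟩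
  by_cases h : i ≤ r
  · exact Tableau.extend_vertex _ _ i h
  · obtain rfl : i = r + 1 := by omega
    rw [t.vertex_last, Tableau.vertex_last]

end CellularTower

/-! ### The seminormal basis -/

namespace DiagramTower

variable {R : Type u} {F : Type uF} {A : ℕ → Type v} [CommRing R] [Field F] [Algebra R F]
  [∀ r, Ring (A r)] [∀ r, Algebra R (A r)] (T : DiagramTower.{u, uF, v, w, w'} R F A)

-- Tableaux of different lengths and shapes have different types, so the products are compared
-- through common initial vertices.
variable {T} in
lemma dProd_congr {r r' : ℕ} {lam : T.Vertex r} {lam' : T.Vertex r'} (t : T.Tableau r lam)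
    (t' : T.Tableau r' lam') : ∀ (s : ℕ) (h : s ≤ r) (h' : s ≤ r')
    (_ : ∀ i (hi : i ≤ s), t.vertex i (hi.trans h) = t'.vertex i (hi.trans h')),
    T.dProd t s h = T.dProd t' s h'
  | 0, _, _, _ => rfl
  | s + 1, h, h', hv => by
    rw [dProd, dProd, dProd_congr t t' s _ _ fun i hi => hv i (Nat.le_succ_of_le hi),
      hv (s + 1) le_rfl, hv s (Nat.le_succ s)]

variable {T} in
lemma gzProd_congr {r r' : ℕ} {lam : T.Vertex r} {lam' : T.Vertex r'} (t : T.Tableau r lam)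
    (t' : T.Tableau r' lam') : ∀ (s : ℕ) (h : s ≤ r) (h' : s ≤ r')
    (_ : ∀ i (hi : i ≤ s), t.vertex i (hi.trans h) = t'.vertex i (hi.trans h')),
    T.gzProd t s h = T.gzProd t' s h'
  | 0, _, _, _ => rfl
  | s + 1, h, h', hv => by
    rw [gzProd, gzProd, gzProd_congr t t' s _ _ fun i hi => hv i (Nat.le_succ_of_le hi),
      hv (s + 1) le_rfl]

/-- The last factor $z_\lambda$ acts trivially and may be dropped; what remains after
$d_{\mu\to\lambda}$ comes from $A_r^{\mathbb F}$, so it is compatible with the filtration. -/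
lemma seminormal_extend {r : ℕ} {mu : T.Vertex r} {lam : T.Vertex (r + 1)}
    (t : T.Tableau r mu) (e : T.Edge mu lam) :
    T.seminormal (t.extend e) =
      (T.cell (r + 1)).actF F lam (T.inclF r (1 ⊗ₜ T.dProd t r le_rfl * T.gzIdem t))
        ((T.cell (r + 1)).toCellFₗ F lam
          ((T.cell (r + 1)).act lam (T.d r mu lam) (T.gen (r + 1) lam))) := by
  rw [seminormal, gzIdem, gzProd, murphy, dProd, CellularTower.Tableau.vertex_last,
    CellDatum.actF_mul, actF_centralIdem_self, CellularTower.Tableau.extend_vertex,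
    CellularTower.Tableau.vertex_last,
    dProd_congr (t.extend e) t r _ le_rfl (fun i hi => t.extend_vertex e i hi),
    gzProd_congr (t.extend e) t r _ le_rfl (fun i hi => t.extend_vertex e i hi),
    CellDatum.act_mul, ← CellDatum.toCellFₗ_apply, ← CellDatum.actF_toCellFₗ, ← inclF_one_tmul,
    ← CellDatum.actF_mul, ← map_mul]
  · rfl
  · exact le_rfl

/-- $A_0=R$ has rank one. This forces level 0 cell modules to have rank one, the base of the
induction. -/
lemma card_index_zero [IsDomain R] :
    Nat.card (Σ lam : T.Vertex 0, (T.cell 0).M lam × (T.cell 0).M lam) = 1 := by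
  have e : R ≃ₗ[R] A 0 := LinearEquiv.ofBijective (Algebra.linearMap R (A 0)) T.zero_eq
  rw [← Module.finrank_eq_nat_card_basis (T.cell 0).c, ← e.finrank_eq, Module.finrank_self]

lemma subsingleton_index_zero [IsDomain R] :
    Subsingleton (Σ lam : T.Vertex 0, (T.cell 0).M lam × (T.cell 0).M lam) :=
  (Nat.card_eq_one_iff_unique.1 T.card_index_zero).1

lemma card_M_zero [IsDomain R] (lam : T.Vertex 0) : Fintype.card ((T.cell 0).M lam) = 1 := by
  have := T.subsingleton_index_zero
  have h : Subsingleton ((T.cell 0).M lam) := ⟨fun s t => by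
    have h := Subsingleton.elim (⟨lam, s, s⟩ : Σ lam : T.Vertex 0, (T.cell 0).M lam × (T.cell 0).M lam)
      ⟨lam, t, t⟩
    simpa using h⟩
  exact Fintype.card_eq_one_iff.2 ⟨Classical.arbitrary _, fun _ => Subsingleton.elim _ _⟩

/-- The unique tableau at level zero. -/
def tableauZero (lam : T.Vertex 0) : T.Tableau 0 lam where
  vertex _ h := (Nat.le_zero.1 h) ▸ lam
  edge _ h := absurd h (Nat.not_succ_le_zero _)
  vertex_last := rfl

lemma tableau_zero_eq {lam : T.Vertex 0} (t t' : T.Tableau 0 lam) : t = t' :=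
  CellularTower.Tableau.ext_vertex fun i hi => by
    obtain rfl : i = 0 := Nat.le_zero.1 hi
    rw [t.vertex_last, t'.vertex_last]

lemma span_seminormal_zero {lam : T.Vertex 0} (t : T.Tableau 0 lam) :
    ⊤ ≤ Submodule.span F {T.seminormal t} := by
  have h : T.seminormal t = (T.cell 0).toCellFₗ F lam (T.gen 0 lam) := by
    rw [seminormal, gzIdem, gzProd, murphy, dProd, CellDatum.actF_one]
    simp [CellDatum.act, CellDatum.toCellFₗ_apply]
  rw [← CellDatum.span_range_toCellFₗ, Submodule.span_le]
  rintro _ ⟨x, rfl⟩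
  obtain ⟨a, rfl⟩ := T.gen_cyclic 0 lam x
  obtain ⟨c, rfl⟩ := T.zero_eq.2 a
  refine Submodule.mem_span_singleton.2 ⟨algebraMap R F c, ?_⟩
  rw [h, algebraMap_smul, ← map_smul, Algebra.algebraMap_eq_smul_one]
  simp [CellDatum.act]

theorem exists_basis_seminormal [IsDomain R] [IsFractionRing R F] (r : ℕ) (lam : T.Vertex r) :
    ∃ b : Module.Basis (T.Tableau r lam) F ((T.cell r).CellF F lam), ∀ t, b t = T.seminormal t := by
  induction r with
  | zero =>
    let _ : Unique (T.Tableau 0 lam) := ⟨⟨T.tableauZero lam⟩, fun t => T.tableau_zero_eq _ _⟩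
    refine ⟨basisOfTopLeSpanOfCardEqFinrank T.seminormal ?_ ?_,
      fun t => by rw [coe_basisOfTopLeSpanOfCardEqFinrank]⟩
    · rw [Set.range_unique]
      exact T.span_seminormal_zero _
    · simp [T.card_M_zero]
  | succ r ih =>
    obtain ⟨N, hN⟩ := T.d_spec r lam
    choose b hb using ih
    have hfin : ∀ mu, Finite (T.Tableau r mu) := fun mu => Module.Finite.finite_basis (b mu)
    have : ∀ mu, Fintype (T.Tableau r mu) := fun mu => Fintype.ofFinite _
    -- The extended seminormal vector lies over $f_{\mathsf t}$: act on the pair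
    -- $(\delta(\lambda)d_{\mu\to\lambda},\delta(\mu))$ by $d_{\mathsf t}F_{\mathsf t}$.
    have hgraph : ∀ (j : Fin N.length) (t : T.Tableau r (N.label j)),
        (T.seminormal (N.extend ⟨j, t⟩), T.seminormal t) ∈ graphF N j := by
      intro j t
      obtain ⟨h1, h2⟩ := hN j
      have h3 := graphF_act N j (1 ⊗ₜ T.dProd t r le_rfl * T.gzIdem t) (mk_mem_graphF N j ⟨_, h1⟩)
      rw [h2] at h3
      have h4 : T.seminormal t = (T.cell r).actF F (N.label j)
          (1 ⊗ₜ T.dProd t r le_rfl * T.gzIdem t)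
            ((T.cell r).toCellFₗ F (N.label j) (T.gen r (N.label j))) := by
        rw [CellDatum.actF_mul, CellDatum.actF_toCellFₗ]
        rfl
      rw [show N.extend ⟨j, t⟩ = t.extend (N.edge_label j) from rfl, seminormal_extend, h4]
      exact h3
    have hspan : ∀ k, stepF N k ≤
        Submodule.span F (Set.range fun p => T.seminormal (N.extend p)) := by
      intro k
      induction k using Fin.induction with
      | zero => rw [stepF_zero]; exact bot_le
      | succ j ih =>
        refine Submodule.span_le.2 ?_
        rintro _ ⟨x, hx, rfl⟩
        have h1 := mk_mem_graphF N j ⟨x, hx⟩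
        set y := (T.cell r).toCellFₗ F (N.label j) (N.quot j ⟨x, hx⟩)
        -- Expand the image of `x` in the inductive basis and lift it to extended seminormal
        -- vectors; the difference from `x` falls into the previous step.
        have h2 := (graphF N j).sum_mem (t := Finset.univ) fun t _ =>
          (graphF N j).smul_mem ((b _).repr y t) (hgraph j t)
        have h3 := (graphF N j).sub_mem h1 h2
        have h4 : ∑ t, (b _).repr y t • T.seminormal t = y := by
          simp only [← hb]
          exact (b _).sum_repr y
        have h5 : (T.cell (r + 1)).toCellFₗ F lam x -
            ∑ t, (b _).repr y t • T.seminormal (N.extend ⟨j, t⟩) ∈ stepF N j.castSucc := by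
          apply mem_stepF_of_mem_graphF N j
          convert h3 using 1
          ext1
          · simp [Prod.fst_sum]
          · simp [Prod.snd_sum, h4]
        have h6 : ∑ t, (b _).repr y t • T.seminormal (N.extend ⟨j, t⟩) ∈
            Submodule.span F (Set.range fun p => T.seminormal (N.extend p)) :=
          Submodule.sum_mem _ fun t _ => Submodule.smul_mem _ _ (Submodule.subset_span ⟨⟨j, t⟩, rfl⟩)
        simpa using Submodule.add_mem _ (ih h5) h6
    let e := Equiv.ofBijective N.extend ⟨N.extend_injective,
      N.extend_surjective fun mu h => exists_label_eq_of_edge N h⟩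
    refine ⟨(basisOfTopLeSpanOfCardEqFinrank (fun p => T.seminormal (N.extend p)) ?_ ?_).reindex e,
      fun t => ?_⟩
    · rw [← stepF_last N]
      exact hspan _
    · rw [Fintype.card_sigma, Module.finrank_fintype_fun_eq_card, ← sum_card_label N]
      refine Finset.sum_congr rfl fun j _ => ?_
      rw [← Module.finrank_eq_card_basis (b _), Module.finrank_fintype_fun_eq_card]
    · rw [Module.Basis.reindex_apply, coe_basisOfTopLeSpanOfCardEqFinrank]
      exact congrArg T.seminormal (e.apply_symm_apply t)

/-! ### Jucys–Murphy elements -/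

/-- Checked in each matrix component: at `lam` the element is the scalar `k`, elsewhere both sides
vanish. -/
lemma centralIdem_mul_of_act_eq_smul {r : ℕ} {lam : T.Vertex r} {a : A r} {k : R}
    (h : ∀ x, (T.cell r).act lam a x = k • x) :
    T.centralIdem lam * (1 : F) ⊗ₜ[R] a = algebraMap R F k • T.centralIdem lam := by
  obtain ⟨h1, h0⟩ := T.centralIdem_spec lam
  have ha : (T.cell r).rep lam a = k • 1 := by
    apply Matrix.ext_of_single_vecMul
    intro i
    rw [Matrix.vecMul_smul, Matrix.vecMul_one]
    exact h _
  apply (T.cell r).repAll_injective (T.split_semisimple r)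
  funext mu
  rw [CellDatum.repAll_apply, CellDatum.repAll_apply, map_mul, map_smul]
  by_cases hmu : mu = lam
  · subst hmu
    rw [h1, one_mul, CellDatum.repF_one_tmul, ha]
    ext i j
    simp [Matrix.one_apply, apply_ite (algebraMap R F)]
  · rw [h0 mu hmu, zero_mul, smul_zero]

variable {T} {L : ∀ r, A r}

/-- Each later factor $z_{\mathsf t(s')}$ is central in $A_{s'}^{\mathbb F}$, so the element moves
past it to the earlier product. -/
lemma gzProd_mul_inclLE {r : ℕ} {lam : T.Vertex r} (t : T.Tableau r lam) {s s' : ℕ} (hs : s ≤ r)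
    (hss : s ≤ s') (hs' : s' ≤ r) {a : A s} {k : F}
    (h : T.gzProd t s hs * 1 ⊗ₜ a = k • T.gzProd t s hs) :
    T.gzProd t s' hs' * 1 ⊗ₜ T.inclLE hss a = k • T.gzProd t s' hs' := by
  induction s', hss using Nat.le_induction with
  | base => rwa [CellularTower.inclLE_self]
  | succ s' hss ih =>
    have hz := (T.isMinimalCentralIdempotent_centralIdem (t.vertex (s' + 1) hs')).central
    rw [Semigroup.mem_center_iff] at hz
    rw [T.inclLE_succ hss, gzProd, mul_assoc, ← hz, ← inclF_one_tmul, ← mul_assoc, ← map_mul,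
      ih (Nat.le_of_succ_le hs'), map_smul, smul_mul_assoc]

lemma gzProd_mul_incl {r : ℕ} {lam : T.Vertex r} (t : T.Tableau r lam) {s : ℕ} (hs : s + 1 ≤ r)
    {a : A s} {k : F} (h : T.gzProd t s (Nat.le_of_succ_le hs) * 1 ⊗ₜ a =
      k • T.gzProd t s (Nat.le_of_succ_le hs)) :
    T.gzProd t (s + 1) hs * 1 ⊗ₜ T.incl s a = k • T.gzProd t (s + 1) hs := by
  have h1 := gzProd_mul_inclLE t (Nat.le_of_succ_le hs) (Nat.le_succ s) hs h
  rwa [T.inclLE_succ le_rfl, CellularTower.inclLE_self] at h1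

/-- It suffices to check the diagonal action of `L_{s+1}` on the Gelfand–Zeitlin idempotents at level
`s + 1`. -/
lemma actsDiagonally_of_gzProd_mul {kappa : ∀ r, T.Vertex r → T.Vertex (r + 1) → R}
    (h : ∀ (r : ℕ) (lam : T.Vertex r) (t : T.Tableau r lam) (s : ℕ) (hs : s + 1 ≤ r),
      T.gzProd t (s + 1) hs * 1 ⊗ₜ L (s + 1) =
        algebraMap R F (kappa s (t.vertex s (Nat.le_of_succ_le hs)) (t.vertex (s + 1) hs)) •
          T.gzProd t (s + 1) hs) :
    T.ActsDiagonally L kappa := by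
  intro r lam t s hs
  rw [seminormal, gzIdem, ← CellDatum.actF_mul, gzProd_mul_inclLE t hs hs le_rfl (h r lam t s hs),
    CellDatum.actF_smul, algebraMap_smul]

lemma IsAdditiveJM.gzProd_mul_jmSum {dd : ∀ r, T.Vertex r → R} (h : T.IsAdditiveJM L dd)
    {r : ℕ} {lam : T.Vertex r} (t : T.Tableau r lam) (s : ℕ) (hs : s ≤ r) :
    T.gzProd t s hs * 1 ⊗ₜ T.jmSum L s =
      algebraMap R F (dd s (t.vertex s hs)) • T.gzProd t s hs := by
  cases s with
  | zero => simp [jmSum, h.scalar_zero]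
  | succ s =>
    rw [gzProd, mul_assoc, T.centralIdem_mul_of_act_eq_smul (h.scalar s _), mul_smul_comm]

lemma IsMultiplicativeJM.gzProd_mul_jmProd {dd : ∀ r, T.Vertex r → R}
    (h : T.IsMultiplicativeJM L dd) {r : ℕ} {lam : T.Vertex r} (t : T.Tableau r lam) (s : ℕ)
    (hs : s ≤ r) :
    T.gzProd t s hs * 1 ⊗ₜ T.jmProd L s =
      algebraMap R F (dd s (t.vertex s hs)) • T.gzProd t s hs := by
  cases s with
  | zero => simp [jmProd, h.scalar_zero, ← Algebra.TensorProduct.one_def]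
  | succ s =>
    rw [gzProd, mul_assoc, T.centralIdem_mul_of_act_eq_smul (h.scalar s _), mul_smul_comm]

lemma IsAdditiveJM.actsDiagonally {dd : ∀ r, T.Vertex r → R} (h : T.IsAdditiveJM L dd) :
    T.ActsDiagonally L fun r mu lam => dd (r + 1) lam - dd r mu := by
  refine actsDiagonally_of_gzProd_mul fun r lam t s hs => ?_
  have h1 := h.gzProd_mul_jmSum t (s + 1) hs
  have h2 := gzProd_mul_incl t hs (h.gzProd_mul_jmSum t s (Nat.le_of_succ_le hs))
  rw [jmSum, TensorProduct.tmul_add, mul_add, h2, ← eq_sub_iff_add_eq'] at h1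
  rw [h1, map_sub, sub_smul]

lemma IsMultiplicativeJM.isUnit_jmProd {dd : ∀ r, T.Vertex r → R} (h : T.IsMultiplicativeJM L dd)
    (r : ℕ) : IsUnit (T.jmProd L r) := by
  induction r with
  | zero => exact isUnit_one
  | succ r ih => exact (ih.map (T.incl r)).mul (h.isUnit r)

/-- The product of the $L_i$ is a unit acting as a scalar matrix, so the determinant, a positive
power of $d(\lambda)$, is a unit. -/
lemma IsMultiplicativeJM.isUnit_scalar {dd : ∀ r, T.Vertex r → R} (h : T.IsMultiplicativeJM L dd)
    (r : ℕ) (lam : T.Vertex r) : IsUnit (dd r lam) := by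
  cases r with
  | zero => rw [h.scalar_zero]; exact isUnit_one
  | succ r =>
    have ha : (T.cell (r + 1)).rep lam (T.jmProd L (r + 1)) = dd (r + 1) lam • 1 := by
      apply Matrix.ext_of_single_vecMul
      intro i
      rw [Matrix.vecMul_smul, Matrix.vecMul_one]
      exact h.scalar r lam _
    have h1 := ((h.isUnit_jmProd (r + 1)).map ((T.cell (r + 1)).rep lam))
    rw [ha, Matrix.isUnit_iff_isUnit_det, Matrix.det_smul, Matrix.det_one, mul_one,
      isUnit_pow_iff Fintype.card_ne_zero] at h1
    exact h1

lemma IsMultiplicativeJM.actsDiagonally {dd : ∀ r, T.Vertex r → R}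
    (h : T.IsMultiplicativeJM L dd) :
    T.ActsDiagonally L fun r mu lam => dd (r + 1) lam * Ring.inverse (dd r mu) := by
  refine actsDiagonally_of_gzProd_mul fun r lam t s hs => ?_
  have h1 := h.gzProd_mul_jmProd t (s + 1) hs
  have h2 := gzProd_mul_incl t hs (h.gzProd_mul_jmProd t s (Nat.le_of_succ_le hs))
  have h3 : (1 : F) ⊗ₜ[R] T.jmProd L (s + 1) =
      (1 ⊗ₜ T.incl s (T.jmProd L s)) * (1 ⊗ₜ L (s + 1)) := by
    rw [Algebra.TensorProduct.tmul_mul_tmul, one_mul, jmProd]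
  rw [h3, ← mul_assoc, h2, smul_mul_assoc] at h1
  -- `Ring.inverse` is a genuine inverse here because $d(\mu)$ is a unit.
  rw [mul_comm, map_mul, mul_smul, ← h1, smul_smul, ← map_mul,
    Ring.inverse_mul_cancel _ (h.isUnit_scalar s _), map_one, one_smul]

end DiagramTower

theorem mainTheorem3 {R : Type u} {F : Type uF} {A : ℕ → Type v} [CommRing R] [IsDomain R]
    [Field F] [Algebra R F] [IsFractionRing R F] [∀ r, Ring (A r)] [∀ r, Algebra R (A r)]
    (T : DiagramTower.{u, uF, v, w, w'} R F A) :
    (∀ (r : ℕ) (lam : T.Vertex r),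
      ∃ b : Module.Basis (T.Tableau r lam) F ((T.cell r).CellF F lam),
        ∀ t, b t = T.seminormal t) ∧
    (∀ (L : ∀ r, A r) (dd : ∀ r, T.Vertex r → R), T.IsAdditiveJM L dd →
      ∃ kappa : ∀ r, T.Vertex r → T.Vertex (r + 1) → R,
        (∀ (r : ℕ) (mu : T.Vertex r) (lam : T.Vertex (r + 1)), T.Edge mu lam →
          kappa r mu lam = dd (r + 1) lam - dd r mu) ∧
        T.ActsDiagonally L kappa) ∧
    (∀ (L : ∀ r, A r) (dd : ∀ r, T.Vertex r → R), T.IsMultiplicativeJM L dd →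
      ∃ kappa : ∀ r, T.Vertex r → T.Vertex (r + 1) → R,
        (∀ (r : ℕ) (mu : T.Vertex r) (lam : T.Vertex (r + 1)), T.Edge mu lam →
          IsUnit (dd r mu) ∧ kappa r mu lam * dd r mu = dd (r + 1) lam) ∧
        T.ActsDiagonally L kappa) := by
  refine ⟨T.exists_basis_seminormal, fun L dd h => ⟨_, fun _ _ _ _ => rfl, h.actsDiagonally⟩,
    fun L dd h => ⟨_, fun r mu lam _ => ⟨h.isUnit_scalar r mu, ?_⟩, h.actsDiagonally⟩⟩
  rw [mul_assoc, Ring.inverse_mul_cancel _ (h.isUnit_scalar r mu), mul_one]
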